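/- A Fibonacci word is a finite word $w$ in the letters $1,2$; its weight $|w|$ is the sum of its letters, and $\mathbb{YF}_n$ is the set of Fibonacci words of weight $n$. The Young--Fibonacci lattice has the oriented edges $w\nearrow w'$ of the three kinds $w\nearrow 1w$; $2^k1v\nearrow 2^{k+1}v$ ($k\ge0$); and $2^kv\nearrow 2^{\ell}12^{k-\ell}v$ ($1\le \ell\le k$). Let $\dim(w)$ be the number of oriented paths from $\varnothing$ to $w$. For sequences $\vec x=(x_1,x_2,\dots)$, $\vec y=(y_1,y_2,\dots)$ let $A_\ell(\vec x\mid\vec y)$ be the $\ell\times\ell$ tridiagonal determinant with diagonal $x_1,x_2,\dots$, superdiagonal $y_1,y_2,\dots$ and subdiagonal $1,1,\dots$, and let $B_{k}(\vec x\mid\vec y)$ be the $(k+1)\times(k+1)$ tridiagonal determinant whose first row is $(y_1,x_1y_2,0,\dots)$ and whose later rows are $(1,x_3,y_3,0,\dots)$, $(0,1,x_4,y_4,0,\dots)$, etc. The clone Schur functions are defined by $s_{1^k}=A_k(\vec x\mid\vec y)$ and $s_{1^k2u}=B_k(x_{1+|u|},x_{2+|u|},\dots\mid y_{1+|u|},y_{2+|u|},\dots)\,s_u$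 for $k\ge0$. Fix $0<\rho<1$ and take the Charlier specialization $x_k=k+\rho-1$, $y_k=k\rho$. Then the weights $$M_n(w)=\dim(w)\,\frac{s_w(\vec x\mid\vec y)}{x_1\cdots x_n},\qquad w\in\mathbb{YF}_n,$$ are nonnegative and define a probability measure on $\mathbb{YF}_n$ for every $n\ge0$. Let $w\in\mathbb{YF}_n$ be distributed according to $M_n$, and write $w=1^{r_1}21^{r_2}2\cdots21^{r_p}$ with $r_j=r_j(w)\ge0$, and $r_j(w)=0$ for $j>p$. Then for every fixed $k$ the random vector $$\Bigl(\frac{r_j(w)}{n-\sum_{i=1}^{j-1}r_i(w)}\Bigr)_{1\le j\le k}$$ (with $0/0$ read as $0$) converges in distribution, as $n\to\infty$, to $(\eta_{\rho;1},\dots,\eta_{\rho;k})$, where the $\eta_{\rho;j}$ are i.i.d. with distribution $\rho\,\delta_0+(1-\rho)\,\mathrm{beta}(1,\rho)$, that is, $\rho\,\delta_0(d\alpha)+(1-\rho)\rho(1-\alpha)^{\rho-1}\,d\alpha$ on $[0,1]$. Correspondingly, $(r_1(w)/n,\dots,r_k(w)/n)$ converges in distribution to the stick-breaking vector $(X_1,\dots,X_k)$,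 $X_j=(1-\eta_{\rho;1})\cdots(1-\eta_{\rho;j-1})\,\eta_{\rho;j}$. -/

import Mathlib

namespace YoungFibonacci

open MeasureTheory

/-- The two letters of Fibonacci words. -/
inductive Letter
  | one
  | two

/-- A Fibonacci word: a finite word in the letters `1` and `2`, read from left to right. -/
abbrev FibWord := List Letter

/-- The weight `|w|`: the sum of the letters of `w`. -/
def weight : FibWord → ℕ
  | [] => 0
  | Letter.one :: w => weight w + 1
  | Letter.two :: w => weight w + 2

/-- The oriented edges `w ↗ w'` of the Young–Fibonacci lattice. -/
inductive Edge : FibWord → FibWord → Prop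
  /-- `w ↗ 1w`. -/
  | prependOne (w : FibWord) : Edge w (Letter.one :: w)
  /-- `2ᵏ1v ↗ 2ᵏ⁺¹v` for `k ≥ 0`. -/
  | oneToTwo (k : ℕ) (v : FibWord) :
      Edge (List.replicate k Letter.two ++ Letter.one :: v)
        (List.replicate (k + 1) Letter.two ++ v)
  /-- `2ᵏv ↗ 2ˡ12ᵏ⁻ˡv` for `1 ≤ l ≤ k`. -/
  | insertOne (k l : ℕ) (v : FibWord) (hl : 1 ≤ l) (hlk : l ≤ k) :
      Edge (List.replicate k Letter.two ++ v)
        (List.replicate l Letter.two ++ Letter.one :: (List.replicate (k - l) Letter.two ++ v))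

/-- `dim w`: the number of oriented paths from the empty word to `w` in the Young–Fibonacci
lattice. Every edge raises the weight by one, so all these paths have `|w|` steps. -/
noncomputable def dim (w : FibWord) : ℕ :=
  Nat.card {p : Fin (weight w + 1) → FibWord //
    p 0 = [] ∧ p (Fin.last (weight w)) = w ∧ ∀ i : Fin (weight w), Edge (p i.castSucc) (p i.succ)}

/-- The shifted sequence `(u₁₊ᵣ, u₂₊ᵣ, …)`. Sequences `(u₁, u₂, …)` are functions on `ℕ` whose
value at `0` is never used. -/
def shift (u : ℕ → ℝ) (r : ℕ) : ℕ → ℝ := fun i => u (i + r)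

/-- The `ℓ × ℓ` tridiagonal determinant `A_ℓ(x ∣ y)` with diagonal `x₁, x₂, …`, superdiagonal
`y₁, y₂, …` and subdiagonal `1, 1, …`. -/
noncomputable def detA (x y : ℕ → ℝ) (l : ℕ) : ℝ :=
  Matrix.det (Matrix.of fun i j : Fin l =>
    if (j : ℕ) = i then x (i + 1)
    else if (j : ℕ) = i + 1 then y (i + 1)
    else if (i : ℕ) = j + 1 then 1
    else 0)

/-- The `(k+1) × (k+1)` tridiagonal determinant `B_k(x ∣ y)`, whose first row is
`(y₁, x₁y₂, 0, …)` and whose later rows are `(1, x₃, y₃, 0, …)`, `(0, 1, x₄, y₄, 0, …)`, … . -/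
noncomputable def detB (x y : ℕ → ℝ) (k : ℕ) : ℝ :=
  Matrix.det (Matrix.of fun i j : Fin (k + 1) =>
    if (i : ℕ) = 0 then
      if (j : ℕ) = 0 then y 1
      else if (j : ℕ) = 1 then x 1 * y 2
      else 0
    else if (j : ℕ) = i then x (i + 2)
    else if (j : ℕ) = i + 1 then y (i + 2)
    else if (i : ℕ) = j + 1 then 1
    else 0)

/-- `cloneSchurAux x y k w` is the clone Schur function of the word `1ᵏw`. -/
noncomputable def cloneSchurAux (x y : ℕ → ℝ) : ℕ → FibWord → ℝ
  | k, [] => detA x y k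
  | k, Letter.one :: w => cloneSchurAux x y (k + 1) w
  | k, Letter.two :: u =>
      detB (shift x (weight u)) (shift y (weight u)) k * cloneSchurAux x y 0 u

/-- The (biserial) clone Schur function `s_w(x ∣ y)`; its defining recurrence is
`cloneSchur_ones` and `cloneSchur_ones_two`. -/
noncomputable def cloneSchur (x y : ℕ → ℝ) (w : FibWord) : ℝ := cloneSchurAux x y 0 w

theorem cloneSchurAux_ones (x y : ℕ → ℝ) (m k : ℕ) (w : FibWord) :
    cloneSchurAux x y m (List.replicate k Letter.one ++ w) = cloneSchurAux x y (m + k) w := by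
  induction k generalizing m with
  | zero => simp
  | succ k ih =>
    rw [List.replicate_succ, List.cons_append, cloneSchurAux, ih]
    congr 1
    omega

theorem cloneSchur_ones (x y : ℕ → ℝ) (k : ℕ) :
    cloneSchur x y (List.replicate k Letter.one) = detA x y k := by
  have h := cloneSchurAux_ones x y 0 k []
  simpa [cloneSchur, cloneSchurAux] using h

theorem cloneSchur_ones_two (x y : ℕ → ℝ) (k : ℕ) (u : FibWord) :
    cloneSchur x y (List.replicate k Letter.one ++ Letter.two :: u) =
      detB (shift x (weight u)) (shift y (weight u)) k * cloneSchur x y u := by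
  rw [cloneSchur, cloneSchurAux_ones, cloneSchurAux, Nat.zero_add, cloneSchur]

/-- The clone harmonic function `φ_{x,y}(w) = s_w(x ∣ y) / (x₁ ⋯ x_{|w|})`. -/
noncomputable def cloneHarmonic (x y : ℕ → ℝ) (w : FibWord) : ℝ :=
  cloneSchur x y w / ∏ i ∈ Finset.Icc 1 (weight w), x i

/-- The clone coherent weight `M_n(w) = dim(w) φ_{x,y}(w)`, `n = |w|`. -/
noncomputable def cloneWeight (x y : ℕ → ℝ) (w : FibWord) : ℝ :=
  (dim w : ℝ) * cloneHarmonic x y w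

/-- The Charlier specialization, `x_k = k + ρ - 1`. -/
def charlierX (ρ : ℝ) (k : ℕ) : ℝ := (k : ℝ) + ρ - 1

/-- The Charlier specialization, `y_k = k ρ`. -/
def charlierY (ρ : ℝ) (k : ℕ) : ℝ := (k : ℝ) * ρ

/-- `YF n`: the set of Fibonacci words of weight `n`. -/
def YF (n : ℕ) : Type := {w : FibWord // weight w = n}

instance (n : ℕ) : MeasurableSpace (YF n) := ⊤

/-- The Charlier clone coherent measure `M_n` on `YF n`. -/
noncomputable def charlierMeasure (ρ : ℝ) (n : ℕ) : Measure (YF n) :=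
  Measure.sum fun w : YF n =>
    ENNReal.ofReal (cloneWeight (charlierX ρ) (charlierY ρ) w.1) • Measure.dirac w

/-- The runs of `1`s, numbered from `0`: if `w = 1^{r₁} 2 1^{r₂} 2 ⋯ 2 1^{rₚ}`, then
`run j w = r_{j+1}` for `j < p` and `run j w = 0` for `j ≥ p`. -/
def run : ℕ → FibWord → ℕ
  | _, [] => 0
  | 0, Letter.one :: w => run 0 w + 1
  | j + 1, Letter.one :: w => run (j + 1) w
  | 0, Letter.two :: _ => 0
  | j + 1, Letter.two :: w => run j w

/-- The normalized run `r_{j+1}(w) / (n - r₁(w) - ⋯ - r_j(w))` (with `0 / 0 = 0`, a case that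
for `n > 0` only occurs for `w = 1ⁿ` and `j ≥ 1`). -/
noncomputable def normalizedRun (n j : ℕ) (w : FibWord) : ℝ :=
  (run j w : ℝ) / ((n : ℝ) - ∑ i ∈ Finset.range j, (run i w : ℝ))

/-- The law of `η_ρ`: the mixture `ρ δ₀ + (1 - ρ) beta(1, ρ)`. -/
noncomputable def etaLaw (ρ : ℝ) : Measure ℝ :=
  ENNReal.ofReal ρ • Measure.dirac 0 +
    ENNReal.ofReal (1 - ρ) • ProbabilityTheory.betaMeasure 1 ρ

end YoungFibonacci

namespace YoungFibonacci

/-! The measures are regenerative. Both `dim` and the clone Schur function factor over `1ᵏ2u`, so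
`M_n(1ᵏ2u)` is `M_r(u)`, `r = |u|`, times a factor `stepWeight ρ n r` that sees `u` only through `r`
(`charlierWeight_ones_two`). Given the weight `r` left after the first `2`, the rest of the word has
law `M_r`.

For the law of `r`, the recurrence for `B_k` drops to first order under the Charlier specialization
(`charlierB_succ`). Summed over `r < m` it telescopes to `lowerMass_succ_left`: up to a term of
order `1/n`, the probability that `r < m` (or that the word is all ones) is `(1 - ρ) growth ρ m /
growth ρ (n + 1)`. The same recursion gives total mass one. Since `growth ρ n` is asymptotic to `n ^
ρ / Γ(ρ)`, the first normalized run exceeds `t ∈ (0, 1)` with limiting probability `(1 - ρ)(1 - t) ^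
ρ`, the tail of `η_ρ` (`tendsto_expect_tail`).

Joint convergence is by induction on the number of runs (`tendsto_expect_prod`): `r` tends to
infinity in probability, so the later runs may be replaced by their limit whatever the first run is.
Boxes with nonzero endpoints determine the convergence, and the stick-breaking form follows from the
continuous mapping theorem. -/

/-! ### Lower covers and the dimension recursion -/

theorem not_edge_nil (p : FibWord) : ¬ Edge p [] := by
  intro h
  generalize hx : ([] : FibWord) = x at h
  cases h <;> simp at hx

theorem edge_one_cons_iff {p w : FibWord} : Edge p (Letter.one :: w) ↔ p = w := by
  constructor
  · intro h
    generalize hx : Letter.one :: w = x at h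
    cases h with
    | prependOne v => exact (List.cons.inj hx).2.symm
    | oneToTwo k v => simp [List.replicate_succ] at hx
    | insertOne k l v hl hlk =>
      obtain ⟨l, rfl⟩ := Nat.exists_eq_add_of_le' hl
      simp [List.replicate_succ] at hx
  · rintro rfl
    exact Edge.prependOne _

/-- Stripping a leading `2` lowers `k` and `l` by one in the last two kinds of edges. The boundary
cases are `k = 0`, which yields `1u`, and `l = 1`, which becomes a prepended `1` one level down. -/
theorem edge_two_cons_iff {p u : FibWord} :
    Edge p (Letter.two :: u) ↔
      p = Letter.one :: u ∨ ∃ u', p = Letter.two :: u' ∧ Edge u' u := by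
  constructor
  · intro h
    generalize hx : Letter.two :: u = x at h
    cases h with
    | prependOne v => simp at hx
    | oneToTwo k v =>
      simp only [List.replicate_succ, List.cons_append, List.cons.injEq, true_and] at hx
      subst hx
      cases k with
      | zero => left; simp
      | succ k =>
        right
        exact ⟨_, by simp [List.replicate_succ], Edge.oneToTwo k v⟩
    | insertOne k l v hl hlk =>
      obtain ⟨l, rfl⟩ := Nat.exists_eq_add_of_le' hl
      obtain ⟨k, rfl⟩ := Nat.exists_eq_add_of_le' (hl.trans hlk)
      simp only [List.replicate_succ, List.cons_append, List.cons.injEq, true_and,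
        Nat.add_sub_add_right] at hx
      subst hx
      right
      refine ⟨List.replicate k Letter.two ++ v, by simp [List.replicate_succ], ?_⟩
      cases l with
      | zero => exact Edge.prependOne _
      | succ l => exact Edge.insertOne k (l + 1) v (by omega) (by omega)
  · rintro (rfl | ⟨u', rfl, h⟩)
    · exact Edge.oneToTwo 0 u
    · cases h with
      | prependOne => exact Edge.insertOne 1 1 u' le_rfl le_rfl
      | oneToTwo k v => exact Edge.oneToTwo (k + 1) v
      | insertOne k l v hl hlk =>
        have h := Edge.insertOne (k + 1) (l + 1) v (by omega) (by omega)
        simpa [List.replicate_succ] using h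

open Classical in
/-- The lower covers of a word in the Young–Fibonacci lattice. -/
noncomputable def preds : FibWord → Finset FibWord
  | [] => ∅
  | Letter.one :: w => {w}
  | Letter.two :: u => insert (Letter.one :: u) ((preds u).image (Letter.two :: ·))

theorem mem_preds {p w : FibWord} : p ∈ preds w ↔ Edge p w := by
  induction w generalizing p with
  | nil => simp [preds, not_edge_nil]
  | cons a w ih =>
    cases a with
    | one => simp [preds, edge_one_cons_iff]
    | two => simp [preds, edge_two_cons_iff, ih, eq_comm, and_comm]

theorem weight_of_mem_preds {p w : FibWord} (h : p ∈ preds w) : weight w = weight p + 1 := by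
  induction w generalizing p with
  | nil => simp [preds] at h
  | cons a w ih =>
    cases a with
    | one =>
      simp only [preds, Finset.mem_singleton] at h
      simp [weight, h]
    | two =>
      simp only [preds, Finset.mem_insert, Finset.mem_image] at h
      rcases h with rfl | ⟨q, hq, rfl⟩
      · simp [weight]
      · simp [weight, ih hq]

/-- Oriented paths with `n` steps from the empty word to `w`. -/
abbrev LatticePath (n : ℕ) (w : FibWord) : Type :=
  {p : Fin (n + 1) → FibWord //
    p 0 = [] ∧ p (Fin.last n) = w ∧ ∀ i : Fin n, Edge (p i.castSucc) (p i.succ)}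

/-- Removing the last step of a path. -/
def latticePathSuccEquiv (n : ℕ) (w : FibWord) :
    LatticePath (n + 1) w ≃ Σ v : preds w, LatticePath n v where
  toFun p := ⟨⟨p.1 (Fin.last n).castSucc, by
      rw [mem_preds]
      have h := p.2.2.2 (Fin.last n)
      rwa [Fin.succ_last, p.2.2.1] at h⟩,
    ⟨fun i => p.1 i.castSucc, p.2.1, rfl, fun i => p.2.2.2 i.castSucc⟩⟩
  invFun q := ⟨Fin.snoc (α := fun _ => FibWord) q.2.1 w, by
      refine ⟨?_, by simp, fun i => ?_⟩
      · exact (Fin.snoc_castSucc (α := fun _ => FibWord) w q.2.1 0).trans q.2.2.1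
      · induction i using Fin.lastCases with
        | last =>
          rw [Fin.succ_last, Fin.snoc_last, Fin.snoc_castSucc, q.2.2.2.1]
          exact mem_preds.1 q.1.2
        | cast i =>
          rw [← Fin.castSucc_succ, Fin.snoc_castSucc, Fin.snoc_castSucc]
          exact q.2.2.2.2 i⟩
  left_inv p := by
    apply Subtype.ext
    funext i
    induction i using Fin.lastCases with
    | last => simp [p.2.2.1]
    | cast i => simp
  right_inv q := by
    obtain ⟨⟨v, hv⟩, ⟨q, h0, h1, h2⟩⟩ := q
    dsimp only at h1
    subst h1
    refine Sigma.ext (Subtype.ext (by simp)) ?_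
    refine (Subtype.heq_iff_coe_eq fun x => ?_).2 (by funext i; simp)
    simp

instance finite_latticePath (n : ℕ) (w : FibWord) : Finite (LatticePath n w) := by
  induction n generalizing w with
  | zero =>
    refine Finite.of_injective (fun _ => ()) fun p q _ => Subtype.ext (funext fun i => ?_)
    have hi : i = 0 := Subsingleton.elim (α := Fin 1) i 0
    rw [hi, p.2.1, q.2.1]
  | succ n ih => exact Finite.of_equiv _ (latticePathSuccEquiv n w).symm

/-- The number of oriented paths with `n` steps from the empty word to `w`. -/
noncomputable def pathCount (n : ℕ) (w : FibWord) : ℕ := Nat.card (LatticePath n w)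

theorem dim_eq_pathCount (w : FibWord) : dim w = pathCount (weight w) w := rfl

theorem pathCount_succ (n : ℕ) (w : FibWord) :
    pathCount (n + 1) w = ∑ v ∈ preds w, pathCount n v := by
  rw [pathCount, Nat.card_congr (latticePathSuccEquiv n w), Nat.card_sigma]
  exact Finset.sum_coe_sort (preds w) fun v => Nat.card (LatticePath n v)

theorem dim_nil : dim [] = 1 := by
  rw [dim_eq_pathCount, pathCount, Nat.card_eq_one_iff_unique]
  refine ⟨⟨fun p q => Subtype.ext (funext fun i => ?_)⟩,
    ⟨⟨fun _ => [], rfl, rfl, fun i => i.elim0⟩⟩⟩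
  have hi : i = 0 := Subsingleton.elim (α := Fin 1) i 0
  rw [hi, p.2.1, q.2.1]

theorem dim_one_cons (w : FibWord) : dim (Letter.one :: w) = dim w := by
  rw [dim_eq_pathCount, weight, pathCount_succ, preds, Finset.sum_singleton, dim_eq_pathCount]

/-- The lower covers of `2u` are `1u`, contributing the path count of `u`, and the words `2v` with
`v` covered by `u`. By induction the latter contribute `|u|` times the path count of `u`. -/
theorem pathCount_two_cons (n : ℕ) (u : FibWord) (hu : weight u = n) :
    pathCount (n + 2) (Letter.two :: u) = (n + 1) * pathCount n u := by
  classical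
  induction n generalizing u with
  | zero =>
    have hp : preds u = ∅ := Finset.eq_empty_of_forall_notMem fun v hv => by
      have := weight_of_mem_preds hv
      omega
    rw [pathCount_succ, preds, hp]
    simp [pathCount_succ, preds]
  | succ n ih =>
    have hnot : Letter.one :: u ∉ (preds u).image (Letter.two :: ·) := by simp
    rw [pathCount_succ, preds, Finset.sum_insert hnot,
      Finset.sum_image fun _ _ _ _ h => (List.cons.inj h).2]
    have h1 : ∀ v ∈ preds u, pathCount (n + 1 + 1) (Letter.two :: v) = (n + 1) * pathCount n v :=
      fun v hv => ih v (by have := weight_of_mem_preds hv; omega)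
    rw [Finset.sum_congr rfl h1, ← Finset.mul_sum, ← pathCount_succ, pathCount_succ (n + 1), preds,
      Finset.sum_singleton]
    ring

theorem dim_two_cons (u : FibWord) : dim (Letter.two :: u) = (weight u + 1) * dim u := by
  rw [dim_eq_pathCount, weight, pathCount_two_cons _ u rfl, dim_eq_pathCount]

theorem dim_ones_append (k : ℕ) (w : FibWord) :
    dim (List.replicate k Letter.one ++ w) = dim w := by
  induction k with
  | zero => simp
  | succ k ih => rw [List.replicate_succ, List.cons_append, dim_one_cons, ih]

theorem weight_ones_append (k : ℕ) (w : FibWord) :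
    weight (List.replicate k Letter.one ++ w) = weight w + k := by
  induction k with
  | zero => simp
  | succ k ih => rw [List.replicate_succ, List.cons_append, weight, ih, add_assoc]

/-! ### Tridiagonal determinants and the Charlier specialization -/

/-- The three-term recurrence for tridiagonal determinants. -/
theorem det_tridiagonal_succ_succ {R : Type*} [CommRing R] (M : ℕ → ℕ → R)
    (hupper : ∀ i j, i + 1 < j → M i j = 0) (hlower : ∀ i j, j + 1 < i → M i j = 0) (n : ℕ) :
    Matrix.det (Matrix.of fun i j : Fin (n + 2) => M i j) =
      M (n + 1) (n + 1) * Matrix.det (Matrix.of fun i j : Fin (n + 1) => M i j) -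
        M n (n + 1) * M (n + 1) n * Matrix.det (Matrix.of fun i j : Fin n => M i j) := by
  -- Only the last two entries of the last row survive; the minor of the subdiagonal one has a
  -- single nonzero entry in its last column.
  rw [Matrix.det_succ_row _ (Fin.last (n + 1)), Fin.sum_univ_castSucc, Fin.sum_univ_castSucc]
  have hz : ∀ i : Fin n, M (n + 1) i = 0 := fun i => hlower _ _ (by omega)
  have hminor : Matrix.det ((Matrix.of fun i j : Fin (n + 2) => M i j).submatrix
      (Fin.last (n + 1)).succAbove (Fin.last n).castSucc.succAbove) =
      M n (n + 1) * Matrix.det (Matrix.of fun i j : Fin n => M i j) := by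
    rw [Matrix.det_succ_column _ (Fin.last n), Fin.sum_univ_castSucc]
    have hz' : ∀ i : Fin n, M i (n + 1) = 0 := fun i => hupper _ _ (by omega)
    have hs : ((Matrix.of fun i j : Fin (n + 2) => M i j).submatrix
        (Fin.last (n + 1)).succAbove (Fin.last n).castSucc.succAbove).submatrix
        (Fin.last n).succAbove (Fin.last n).succAbove = Matrix.of fun i j : Fin n => M i j := by
      ext i j
      simp [Fin.succAbove_of_castSucc_lt]
    rw [hs]
    simp [hz', Fin.succAbove_of_le_castSucc,
      ← two_mul]
  have hmain : (Matrix.of fun i j : Fin (n + 2) => M i j).submatrix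
      (Fin.last (n + 1)).succAbove (Fin.last (n + 1)).succAbove =
        Matrix.of fun i j : Fin (n + 1) => M i j := by
    ext i j
    simp
  rw [hminor, hmain]
  have hsgn : (-1 : R) ^ (n + 1 + n) = -1 := Odd.neg_one_pow ⟨n, by ring⟩
  simp [hz, hsgn, ← two_mul]
  ring

theorem detA_succ_succ (x y : ℕ → ℝ) (l : ℕ) :
    detA x y (l + 2) = x (l + 2) * detA x y (l + 1) - y (l + 1) * detA x y l := by
  have h := det_tridiagonal_succ_succ (fun i j : ℕ => if j = i then x (i + 1)
    else if j = i + 1 then y (i + 1) else if i = j + 1 then 1 else 0)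
    (fun i j hij => by rw [if_neg, if_neg, if_neg] <;> omega)
    (fun i j hij => by rw [if_neg, if_neg, if_neg] <;> omega) l
  simp only [detA]
  rw [h]
  simp [show l ≠ l + 1 + 1 by omega]

theorem detB_succ_succ (x y : ℕ → ℝ) (k : ℕ) :
    detB x y (k + 2) = x (k + 4) * detB x y (k + 1) - y (k + 3) * detB x y k := by
  have h := det_tridiagonal_succ_succ (fun i j : ℕ => if i = 0 then
      if j = 0 then y 1 else if j = 1 then x 1 * y 2 else 0
    else if j = i then x (i + 2)
    else if j = i + 1 then y (i + 2)
    else if i = j + 1 then 1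
    else 0)
    (fun i j hij => by split_ifs <;> first | rfl | omega)
    (fun i j hij => by split_ifs <;> first | rfl | omega) (k + 1)
  simp only [detB]
  rw [h]
  simp

theorem detB_zero (x y : ℕ → ℝ) : detB x y 0 = y 1 := by
  simp [detB]

theorem detB_one (x y : ℕ → ℝ) : detB x y 1 = y 1 * x 3 - x 1 * y 2 := by
  simp [detB, Matrix.det_fin_two]

theorem detA_charlier (ρ : ℝ) (l : ℕ) : detA (charlierX ρ) (charlierY ρ) l = ρ ^ l := by
  induction l using Nat.twoStepInduction with
  | zero => simp [detA]
  | one => simp [detA, charlierX]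
  | more l h0 h1 =>
    rw [detA_succ_succ, h0, h1, charlierX, charlierY]
    push_cast
    ring

/-- The determinant `B_k` of the Charlier specialization, shifted by `r`. -/
noncomputable def charlierB (ρ : ℝ) (r k : ℕ) : ℝ :=
  detB (shift (charlierX ρ) r) (shift (charlierY ρ) r) k

theorem charlierB_zero (ρ : ℝ) (r : ℕ) : charlierB ρ r 0 = (r + 1) * ρ := by
  rw [charlierB, detB_zero, shift, charlierY]
  push_cast
  ring

/-- The three-term recurrence factors as `B_{k+2} - ρ B_{k+1} = (r + k + 3)(B_{k+1} - ρ B_k)`, so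
`B_{k+1} - ρ B_k` is a ratio of factorials times its initial value. This form also makes positivity
visible. -/
theorem charlierB_succ (ρ : ℝ) (r k : ℕ) :
    charlierB ρ r (k + 1) =
      ρ * charlierB ρ r k + ρ * (1 - ρ) * ((r + k + 2).factorial / (r + 1).factorial) := by
  have hf : ∀ m : ℕ, (m.factorial : ℝ) ≠ 0 := fun m => by positivity
  induction k with
  | zero =>
    rw [charlierB_zero, charlierB, zero_add, detB_one]
    simp only [shift, charlierX, charlierY, add_zero]
    rw [Nat.factorial_succ (r + 1)]
    have := hf (r + 1)
    push_cast
    field_simp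
    ring
  | succ k ih =>
    have h : charlierB ρ r (k + 1 + 1) = (r + k + 3 + ρ) * charlierB ρ r (k + 1) -
        (r + k + 3) * ρ * charlierB ρ r k := by
      simp only [charlierB]
      rw [detB_succ_succ]
      simp only [shift, charlierX, charlierY]
      push_cast
      ring
    rw [h, ← add_assoc r k 1, show r + k + 1 + 2 = (r + k + 2) + 1 by ring,
      Nat.factorial_succ (r + k + 2)]
    have := hf (r + 1)
    push_cast
    linear_combination (r + k + 3 : ℝ) * ih

theorem charlierB_nonneg {ρ : ℝ} (hρ0 : 0 ≤ ρ) (hρ1 : ρ ≤ 1) (r k : ℕ) :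
    0 ≤ charlierB ρ r k := by
  induction k with
  | zero => rw [charlierB_zero]; positivity
  | succ k ih =>
    rw [charlierB_succ]
    have : 0 ≤ 1 - ρ := by linarith
    positivity

/-! ### Factorization of the weights at the first `2` -/

/-- The rising factorial `ρ (ρ + 1) ⋯ (ρ + n - 1)`. -/
noncomputable def rising (ρ : ℝ) (n : ℕ) : ℝ := ∏ i ∈ Finset.range n, (ρ + i)

theorem rising_succ (ρ : ℝ) (n : ℕ) : rising ρ (n + 1) = rising ρ n * (ρ + n) :=
  Finset.prod_range_succ _ _

theorem rising_pos {ρ : ℝ} (hρ : 0 < ρ) (n : ℕ) : 0 < rising ρ n :=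
  Finset.prod_pos fun i _ => by positivity

theorem prod_charlierX (ρ : ℝ) (n : ℕ) :
    ∏ i ∈ Finset.Icc 1 n, charlierX ρ i = rising ρ n := by
  induction n with
  | zero => simp [rising]
  | succ n ih =>
    rw [Finset.prod_Icc_succ_top (by omega), ih, rising_succ, charlierX]
    push_cast
    ring

/-- The Charlier weight `M_n(w)`, `n = |w|`. -/
noncomputable def charlierWeight (ρ : ℝ) (w : FibWord) : ℝ :=
  cloneWeight (charlierX ρ) (charlierY ρ) w

/-- The probability that `w ∈ YF n` has the form `1ᵏ2u` with `|u| = r`. -/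
noncomputable def stepWeight (ρ : ℝ) (n r : ℕ) : ℝ :=
  (r + 1) * charlierB ρ r (n - 2 - r) * rising ρ r / rising ρ n

theorem charlierWeight_ones (ρ : ℝ) (n : ℕ) :
    charlierWeight ρ (List.replicate n Letter.one) = ρ ^ n / rising ρ n := by
  have hd := dim_ones_append n []
  have hw := weight_ones_append n []
  rw [List.append_nil] at hd hw
  rw [charlierWeight, cloneWeight, cloneHarmonic, cloneSchur_ones, detA_charlier, prod_charlierX,
    hd, hw, dim_nil, weight]
  simp

/-- The regeneration property: the first factor depends on `u` only through its weight. -/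
theorem charlierWeight_ones_two {ρ : ℝ} (hρ : 0 < ρ) (k : ℕ) (u : FibWord) :
    charlierWeight ρ (List.replicate k Letter.one ++ Letter.two :: u) =
      stepWeight ρ (weight u + 2 + k) (weight u) * charlierWeight ρ u := by
  have h := (rising_pos hρ (weight u)).ne'
  rw [charlierWeight, cloneWeight, cloneHarmonic, cloneSchur_ones_two, prod_charlierX,
    dim_ones_append, dim_two_cons, weight_ones_append, weight, charlierWeight, cloneWeight,
    cloneHarmonic, prod_charlierX, stepWeight, charlierB,
    show weight u + 2 + k - 2 - weight u = k by omega]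
  push_cast
  field_simp

theorem stepWeight_nonneg {ρ : ℝ} (hρ0 : 0 < ρ) (hρ1 : ρ ≤ 1) (n r : ℕ) :
    0 ≤ stepWeight ρ n r := by
  have := charlierB_nonneg hρ0.le hρ1 r (n - 2 - r)
  have := rising_pos hρ0 r
  have := rising_pos hρ0 n
  rw [stepWeight]
  positivity

theorem exists_ones_two (w : FibWord) :
    w = List.replicate (weight w) Letter.one ∨
      ∃ k u, w = List.replicate k Letter.one ++ Letter.two :: u := by
  induction w with
  | nil => left; rfl
  | cons a w ih =>
    cases a with
    | two => exact Or.inr ⟨0, w, rfl⟩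
    | one =>
      rcases ih with ih | ⟨k, u, rfl⟩
      · left
        rw [weight, List.replicate_succ, ← ih]
      · exact Or.inr ⟨k + 1, u, rfl⟩

theorem charlierWeight_nonneg {ρ : ℝ} (hρ0 : 0 < ρ) (hρ1 : ρ ≤ 1) (w : FibWord) :
    0 ≤ charlierWeight ρ w := by
  induction hn : weight w using Nat.strong_induction_on generalizing w with
  | _ n ih =>
    rcases exists_ones_two w with h | ⟨k, u, rfl⟩
    · rw [h, charlierWeight_ones]
      have := rising_pos hρ0 (weight w)
      positivity
    · rw [charlierWeight_ones_two hρ0]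
      rw [weight_ones_append, weight] at hn
      exact mul_nonneg (stepWeight_nonneg hρ0 hρ1 _ _) (ih (weight u) (by omega) u rfl)

/-! ### The law of the weight remaining after the first `2` -/

/-- The sequence `(ρ)ₙ / (n - 1)!`, of order `n ^ ρ`. -/
noncomputable def growth (ρ : ℝ) (n : ℕ) : ℝ := n * rising ρ n / n.factorial

theorem growth_zero (ρ : ℝ) : growth ρ 0 = 0 := by simp [growth]

theorem growth_succ (ρ : ℝ) (n : ℕ) : growth ρ (n + 1) = rising ρ (n + 1) / n.factorial := by
  rw [growth, Nat.factorial_succ]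
  push_cast
  field_simp

theorem growth_succ_sub (ρ : ℝ) (r : ℕ) :
    growth ρ (r + 1) - growth ρ r = ρ * rising ρ r / r.factorial := by
  rw [growth_succ, growth, rising_succ]
  ring

/-- This is `charlierB_succ` divided by the rising factorial; its inhomogeneous term is an increment
in `r`, so sums over `r` telescope. -/
theorem stepWeight_succ {ρ : ℝ} (hρ : 0 < ρ) {n r : ℕ} (hr : r + 1 < n) :
    stepWeight ρ (n + 1) r = ρ / (ρ + n) * stepWeight ρ n r +
      (1 - ρ) * (growth ρ (r + 1) - growth ρ r) / growth ρ (n + 1) := by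
  obtain ⟨j, rfl⟩ := Nat.exists_eq_add_of_le (show r + 2 ≤ n from hr)
  have h1 := (rising_pos hρ (r + 2 + j)).ne'
  have h2 : ρ + ((r + 2 + j : ℕ) : ℝ) ≠ 0 := by positivity
  rw [growth_succ_sub, growth_succ, stepWeight, stepWeight,
    show r + 2 + j + 1 - 2 - r = j + 1 by omega, show r + 2 + j - 2 - r = j by omega,
    charlierB_succ, rising_succ, Nat.factorial_succ r, show r + j + 2 = r + 2 + j by omega]
  generalize ((r + 2 + j : ℕ) : ℝ) = x at *
  push_cast
  field_simp

/-- The probability that `w ∈ YF n` is `1ⁿ` or has the form `1ᵏ2u` with `|u| < m`. -/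
noncomputable def lowerMass (ρ : ℝ) (n m : ℕ) : ℝ :=
  ρ ^ n / rising ρ n + ∑ r ∈ Finset.range m, stepWeight ρ n r

/-- The mass of `1ⁿ` satisfies the homogeneous part of the recursion for `stepWeight`, which is why
it is included in `lowerMass`. -/
theorem lowerMass_succ_left {ρ : ℝ} (hρ : 0 < ρ) {n m : ℕ} (hm : m < n) :
    lowerMass ρ (n + 1) m = ρ / (ρ + n) * lowerMass ρ n m +
      (1 - ρ) * (growth ρ m / growth ρ (n + 1)) := by
  have h1 := (rising_pos hρ n).ne'
  have h2 : ρ + (n : ℝ) ≠ 0 := by positivity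
  have h3 : ∀ r ∈ Finset.range m, stepWeight ρ (n + 1) r = ρ / (ρ + n) * stepWeight ρ n r +
      (1 - ρ) / growth ρ (n + 1) * (growth ρ (r + 1) - growth ρ r) := fun r hr => by
    rw [Finset.mem_range] at hr
    rw [stepWeight_succ hρ (by omega)]
    ring
  rw [lowerMass, lowerMass, Finset.sum_congr rfl h3, Finset.sum_add_distrib, ← Finset.mul_sum,
    ← Finset.mul_sum, Finset.sum_range_sub, growth_zero, rising_succ, pow_succ]
  field_simp
  ring

theorem lowerMass_succ_right (ρ : ℝ) (n m : ℕ) :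
    lowerMass ρ n (m + 1) = lowerMass ρ n m + stepWeight ρ n m := by
  rw [lowerMass, Finset.sum_range_succ, lowerMass, add_assoc]

/-- At level `n + 1` the remaining weight is at most `n - 1`, so this is the total mass. The
induction raises the level by `lowerMass_succ_left` and adds the one new term, where the first run
is empty. -/
theorem lowerMass_succ_self {ρ : ℝ} (hρ : 0 < ρ) (n : ℕ) : lowerMass ρ (n + 1) n = 1 := by
  induction n with
  | zero => simp [lowerMass, rising, hρ.ne']
  | succ n ih =>
    have h1 := (rising_pos hρ n).ne'
    have h2 : ρ + (n : ℝ) ≠ 0 := by positivity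
    have h3 : ρ + ((n : ℝ) + 1) ≠ 0 := by positivity
    rw [lowerMass_succ_right, lowerMass_succ_left hρ (Nat.lt_succ_self n), ih, stepWeight,
      show n + 1 + 1 - 2 - n = 0 by omega, charlierB_zero, growth_succ, growth, rising_succ,
      rising_succ, Nat.factorial_succ]
    push_cast
    field_simp
    ring

theorem lowerMass_nonneg {ρ : ℝ} (hρ0 : 0 < ρ) (hρ1 : ρ ≤ 1) (n m : ℕ) :
    0 ≤ lowerMass ρ n m := by
  have := rising_pos hρ0 n
  have := Finset.sum_nonneg fun r (_ : r ∈ Finset.range m) => stepWeight_nonneg hρ0 hρ1 n r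
  rw [lowerMass]
  positivity

theorem lowerMass_le_one {ρ : ℝ} (hρ0 : 0 < ρ) (hρ1 : ρ ≤ 1) {n m : ℕ} (hm : m < n) :
    lowerMass ρ n m ≤ 1 := by
  obtain ⟨n, rfl⟩ := Nat.exists_eq_add_of_le' (Nat.one_le_of_lt hm)
  rw [← lowerMass_succ_self hρ0 n, lowerMass, lowerMass]
  gcongr with r
  · exact fun r _ _ => stepWeight_nonneg hρ0 hρ1 _ _
  · omega

/-! ### Expectations, conditioned on the first `2` -/

open Classical in
/-- The Fibonacci words of weight `n`. -/
noncomputable def words : ℕ → Finset FibWord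
  | 0 => {[]}
  | 1 => {[Letter.one]}
  | n + 2 => (words (n + 1)).image (Letter.one :: ·) ∪ (words n).image (Letter.two :: ·)

theorem mem_words {n : ℕ} {w : FibWord} : w ∈ words n ↔ weight w = n := by
  induction n using Nat.twoStepInduction generalizing w with
  | zero => rcases w with _ | ⟨_ | _, w⟩ <;> simp [words, weight]
  | one =>
    rcases w with _ | ⟨_ | _, w⟩
    · simp [words, weight]
    · rcases w with _ | ⟨_ | _, w⟩ <;> simp [words, weight]
    · simp [words, weight]
  | more n h0 h1 =>
    rcases w with _ | ⟨_ | _, w⟩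
    · simp [words, weight]
    · simp [words, weight, h1]
    · simp [words, weight, h0]

theorem sum_words_add_two (n : ℕ) (g : FibWord → ℝ) :
    ∑ w ∈ words (n + 2), g w =
      ∑ w ∈ words (n + 1), g (Letter.one :: w) + ∑ u ∈ words n, g (Letter.two :: u) := by
  classical
  rw [words, Finset.sum_union, Finset.sum_image fun _ _ _ _ h => (List.cons.inj h).2,
    Finset.sum_image fun _ _ _ _ h => (List.cons.inj h).2]
  rw [Finset.disjoint_left]
  intro w h1 h2
  simp only [Finset.mem_image] at h1 h2
  obtain ⟨a, -, rfl⟩ := h1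
  obtain ⟨b, -, h⟩ := h2
  simp at h

theorem sum_words_succ (m : ℕ) (g : FibWord → ℝ) :
    ∑ w ∈ words (m + 1), g w = g (List.replicate (m + 1) Letter.one) +
      ∑ r ∈ Finset.range m, ∑ u ∈ words r,
        g (List.replicate (m - 1 - r) Letter.one ++ Letter.two :: u) := by
  induction m generalizing g with
  | zero => simp [words]
  | succ m ih =>
    rw [sum_words_add_two, ih, Finset.sum_range_succ, ← List.replicate_succ, ← add_assoc]
    congr 1
    · congr 1
      refine Finset.sum_congr rfl fun r hr => Finset.sum_congr rfl fun u _ => ?_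
      rw [Finset.mem_range] at hr
      rw [← List.cons_append, ← List.replicate_succ, show m - 1 - r + 1 = m + 1 - 1 - r by omega]
    · simp

/-- The expectation of `g` with respect to the Charlier weights of level `n`. -/
noncomputable def expect (ρ : ℝ) (n : ℕ) (g : FibWord → ℝ) : ℝ :=
  ∑ w ∈ words n, charlierWeight ρ w * g w

theorem expect_congr {ρ : ℝ} {n : ℕ} {g h : FibWord → ℝ} (hgh : ∀ w, weight w = n → g w = h w) :
    expect ρ n g = expect ρ n h :=
  Finset.sum_congr rfl fun w hw => by rw [hgh w (mem_words.1 hw)]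

theorem expect_const_mul (ρ : ℝ) (n : ℕ) (c : ℝ) (g : FibWord → ℝ) :
    expect ρ n (fun w => c * g w) = c * expect ρ n g := by
  rw [expect, expect, Finset.mul_sum]
  exact Finset.sum_congr rfl fun w _ => by ring

theorem expect_sub (ρ : ℝ) (n : ℕ) (g h : FibWord → ℝ) :
    expect ρ n (fun w => g w - h w) = expect ρ n g - expect ρ n h := by
  simp only [expect, mul_sub, Finset.sum_sub_distrib]

/-- Conditioning on the remaining weight `r`; the first run then has length `m - 1 - r`. -/
theorem expect_succ {ρ : ℝ} (hρ : 0 < ρ) (m : ℕ) (g : FibWord → ℝ) :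
    expect ρ (m + 1) g =
      ρ ^ (m + 1) / rising ρ (m + 1) * g (List.replicate (m + 1) Letter.one) +
      ∑ r ∈ Finset.range m, stepWeight ρ (m + 1) r *
        expect ρ r fun u => g (List.replicate (m - 1 - r) Letter.one ++ Letter.two :: u) := by
  rw [expect, sum_words_succ, charlierWeight_ones]
  congr 1
  refine Finset.sum_congr rfl fun r hr => ?_
  rw [expect, Finset.mul_sum]
  refine Finset.sum_congr rfl fun u hu => ?_
  rw [Finset.mem_range] at hr
  rw [charlierWeight_ones_two hρ, mem_words.1 hu, show r + 2 + (m - 1 - r) = m + 1 by omega]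
  ring

theorem expect_one {ρ : ℝ} (hρ : 0 < ρ) (n : ℕ) : expect ρ n (fun _ => 1) = 1 := by
  induction n using Nat.strong_induction_on with
  | _ n ih =>
    cases n with
    | zero =>
      have h := charlierWeight_ones ρ 0
      simp [expect, words, rising] at h ⊢
      exact h
    | succ m =>
      have h := lowerMass_succ_self hρ m
      rw [lowerMass] at h
      rw [expect_succ hρ, mul_one]
      refine Eq.trans ?_ h
      congr 1
      refine Finset.sum_congr rfl fun r hr => ?_
      rw [Finset.mem_range] at hr
      rw [ih r (by omega), mul_one]

theorem abs_expect_le_one {ρ : ℝ} (hρ0 : 0 < ρ) (hρ1 : ρ ≤ 1) (n : ℕ) {g : FibWord → ℝ}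
    (hg : ∀ w, |g w| ≤ 1) : |expect ρ n g| ≤ 1 := by
  rw [← expect_one hρ0 n]
  refine (Finset.abs_sum_le_sum_abs _ _).trans (Finset.sum_le_sum fun w _ => ?_)
  have h := charlierWeight_nonneg hρ0 hρ1 w
  rw [abs_mul, abs_of_nonneg h]
  exact mul_le_mul_of_nonneg_left (hg w) h

/-! ### Runs of ones -/

theorem run_zero_ones_two (k : ℕ) (u : FibWord) :
    run 0 (List.replicate k Letter.one ++ Letter.two :: u) = k := by
  induction k with
  | zero => rfl
  | succ k ih => rw [List.replicate_succ, List.cons_append, run, ih]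

theorem run_succ_ones_two (j k : ℕ) (u : FibWord) :
    run (j + 1) (List.replicate k Letter.one ++ Letter.two :: u) = run j u := by
  induction k with
  | zero => rfl
  | succ k ih => rw [List.replicate_succ, List.cons_append, run, ih]

theorem run_zero_ones (k : ℕ) : run 0 (List.replicate k Letter.one) = k := by
  induction k with
  | zero => rfl
  | succ k ih => rw [List.replicate_succ, run, ih]

theorem sum_run_le_weight (j : ℕ) (w : FibWord) :
    ∑ i ∈ Finset.range j, run i w ≤ weight w := by
  induction w generalizing j with
  | nil => simp [run]
  | cons a w ih =>
    cases j with
    | zero => simp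
    | succ j =>
      rw [Finset.sum_range_succ']
      cases a with
      | one =>
        have h := ih (j + 1)
        rw [Finset.sum_range_succ'] at h
        simp only [run, weight]
        omega
      | two =>
        have h := ih j
        simp only [run, weight]
        omega

/-! ### Limit of the first run -/

open Filter Topology

theorem growth_pos {ρ : ℝ} (hρ : 0 < ρ) (n : ℕ) : 0 < growth ρ (n + 1) := by
  have := rising_pos hρ (n + 1)
  rw [growth_succ]
  positivity

/-- Euler's limit for the Gamma function: the quotient equals `n / (n + ρ)` divided by
`Real.GammaSeq ρ n`. -/
theorem tendsto_growth_div_rpow {ρ : ℝ} (hρ : 0 < ρ) :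
    Tendsto (fun n : ℕ => growth ρ n / (n : ℝ) ^ ρ) atTop (𝓝 (1 / Real.Gamma ρ)) := by
  have h1 : Tendsto (fun n : ℕ => (n : ℝ) / (n + ρ)) atTop (𝓝 1) :=
    tendsto_natCast_div_add_atTop ρ
  refine (h1.div (Real.GammaSeq_tendsto_Gamma ρ) (Real.Gamma_pos_of_pos hρ).ne').congr' ?_
  filter_upwards [eventually_gt_atTop 0] with n hn
  have h2 := (rising_pos hρ n).ne'
  have h3 : (n : ℝ) + ρ ≠ 0 := by positivity
  have h4 : (n : ℝ) ^ ρ ≠ 0 := by positivity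
  have h5 : Real.GammaSeq ρ n = (n : ℝ) ^ ρ * n.factorial / (rising ρ n * (n + ρ)) := by
    rw [add_comm (n : ℝ), ← rising_succ]
    rfl
  simp only [Pi.div_apply]
  rw [h5, growth]
  field_simp

theorem tendsto_growth_atTop {ρ : ℝ} (hρ : 0 < ρ) : Tendsto (growth ρ) atTop atTop := by
  have h := (tendsto_growth_div_rpow hρ).pos_mul_atTop
    (by have := Real.Gamma_pos_of_pos hρ; positivity)
    ((tendsto_rpow_atTop hρ).comp tendsto_natCast_atTop_atTop)
  refine h.congr' ?_
  filter_upwards [eventually_gt_atTop 0] with n hn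
  have h4 : (n : ℝ) ^ ρ ≠ 0 := by positivity
  simp only [Function.comp_apply]
  field_simp

theorem tendsto_growth_div_growth {ρ : ℝ} (hρ : 0 < ρ) {u v : ℕ → ℕ} {s : ℝ}
    (hu : Tendsto u atTop atTop) (hv : Tendsto v atTop atTop)
    (huv : Tendsto (fun n => (u n : ℝ) / v n) atTop (𝓝 s)) :
    Tendsto (fun n => growth ρ (u n) / growth ρ (v n)) atTop (𝓝 (s ^ ρ)) := by
  have hΓ := Real.Gamma_pos_of_pos hρ
  have h1 := ((tendsto_growth_div_rpow hρ).comp hu).div ((tendsto_growth_div_rpow hρ).comp hv)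
    (by positivity)
  have h2 := h1.mul (huv.rpow_const (Or.inr hρ.le))
  rw [div_self (by positivity), one_mul] at h2
  refine h2.congr' ?_
  filter_upwards [hu.eventually_gt_atTop 0, hv.eventually_gt_atTop 0] with n hun hvn
  have h3 : (u n : ℝ) ^ ρ ≠ 0 := by positivity
  have h4 : (v n : ℝ) ^ ρ ≠ 0 := by positivity
  have h5 : growth ρ (v n) ≠ 0 := by
    obtain ⟨m, hm⟩ := Nat.exists_eq_add_of_le' (show 1 ≤ v n from hvn)
    rw [hm]
    exact (growth_pos hρ m).ne'
  rw [Real.div_rpow (by positivity) (by positivity)]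
  simp only [Pi.div_apply, Function.comp_apply]
  field_simp

/-- One step of `lowerMass_succ_left` suffices: the mass at the previous level is at most one and
carries a factor `ρ / (ρ + n)`. -/
theorem tendsto_lowerMass {ρ : ℝ} (hρ0 : 0 < ρ) (hρ1 : ρ ≤ 1) {u : ℕ → ℕ} {s : ℝ}
    (hu : ∀ᶠ n in atTop, u n < n)
    (hs : Tendsto (fun n => growth ρ (u n) / growth ρ (n + 1)) atTop (𝓝 s)) :
    Tendsto (fun n => lowerMass ρ (n + 1) (u n)) atTop (𝓝 ((1 - ρ) * s)) := by
  have h1 : Tendsto (fun n : ℕ => ρ / (ρ + n)) atTop (𝓝 0) :=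
    tendsto_const_nhds.div_atTop (tendsto_const_nhds.add_atTop tendsto_natCast_atTop_atTop)
  have h2 : Tendsto (fun n : ℕ => ρ / (ρ + n) * lowerMass ρ n (u n)) atTop (𝓝 0) := by
    refine squeeze_zero' (Eventually.of_forall fun n => ?_) ?_ h1
    · have := lowerMass_nonneg hρ0 hρ1 n (u n)
      positivity
    · filter_upwards [hu] with n hn
      exact mul_le_of_le_one_right (by positivity) (lowerMass_le_one hρ0 hρ1 hn)
  have h3 := h2.add (hs.const_mul (1 - ρ))
  rw [zero_add] at h3
  refine h3.congr' ?_
  filter_upwards [hu] with n hn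
  rw [lowerMass_succ_left hρ0 hn]

/-- The remaining weight tends to infinity in probability, because `growth` does. -/
theorem tendsto_lowerMass_const {ρ : ℝ} (hρ0 : 0 < ρ) (hρ1 : ρ ≤ 1) (R : ℕ) :
    Tendsto (fun n => lowerMass ρ (n + 1) R) atTop (𝓝 0) := by
  have h := tendsto_lowerMass hρ0 hρ1 (u := fun _ => R) (eventually_gt_atTop R)
    (tendsto_const_nhds.div_atTop ((tendsto_growth_atTop hρ0).comp (tendsto_add_atTop_nat 1)))
  simpa using h

/-- The tail function of `ρ δ₀ + (1 - ρ) beta(1, ρ)` away from `0`. -/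
noncomputable def etaTail (ρ t : ℝ) : ℝ :=
  if t < 0 then 1 else if t < 1 then (1 - ρ) * (1 - t) ^ ρ else 0

theorem run_zero_div_le_one (a : ℕ) (w : FibWord) :
    (run 0 w : ℝ) / (weight w + a) ≤ 1 := by
  refine div_le_one_of_le₀ ?_ (by positivity)
  have h := sum_run_le_weight 1 w
  rw [Finset.sum_range_one] at h
  exact_mod_cast h.trans (Nat.le_add_right _ a)

open Classical in
-- A long first run means a small remaining weight, so for `0 < t < 1` the expectation is eventually
-- a `lowerMass`. The offset `a` accounts for letters `2` already removed.
theorem tendsto_expect_tail {ρ : ℝ} (hρ0 : 0 < ρ) (hρ1 : ρ ≤ 1) {t : ℝ} (ht : t ≠ 0) (a : ℕ) :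
    Tendsto (fun n : ℕ => expect ρ n fun w => if t < (run 0 w : ℝ) / (n + a) then 1 else 0) atTop
      (𝓝 (etaTail ρ t)) := by
  rcases lt_or_gt_of_ne ht with h0 | h0
  · rw [etaTail, if_pos h0]
    refine tendsto_const_nhds.congr fun n => ?_
    refine (expect_one hρ0 n).symm.trans (expect_congr fun w _ => (if_pos ?_).symm)
    exact h0.trans_le (by positivity)
  rcases le_or_gt 1 t with h1 | h1
  · rw [etaTail, if_neg h0.not_gt, if_neg h1.not_gt]
    refine tendsto_const_nhds.congr fun n => ?_
    have h : expect ρ n (fun w => if t < (run 0 w : ℝ) / (n + a) then 1 else 0) =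
        expect ρ n (fun _ => 0) := expect_congr fun w hw => by
      subst hw
      exact if_neg ((run_zero_div_le_one a w).trans h1).not_gt
    rw [h]
    simp [expect]
  rw [etaTail, if_neg h0.not_gt, if_pos h1, ← tendsto_add_atTop_iff_nat 1]
  -- At level `m + 1` the first run is `m - 1 - r`; it exceeds `t (m + 1 + a)` exactly when `r` is
  -- below this ceiling.
  set u : ℕ → ℕ := fun m => ⌈(m : ℝ) - 1 - t * ((m : ℝ) + 1 + a)⌉₊ with hu
  have hum : ∀ᶠ m in atTop, u m < m := by
    filter_upwards [eventually_gt_atTop 0] with m hm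
    have h2 : (1 : ℝ) ≤ m := by exact_mod_cast hm
    have h3 : u m ≤ m - 1 := by
      rw [hu, Nat.ceil_le]
      push_cast [hm]
      have : 0 ≤ t * ((m : ℝ) + 1 + a) := by positivity
      linarith
    omega
  have hlin : Tendsto (fun m : ℕ => ((m : ℝ) - 1 - t * ((m : ℝ) + 1 + a)) / (m + 1 : ℕ)) atTop
      (𝓝 (1 - t)) := by
    have hc : Tendsto (fun m : ℕ => (2 + t * a) / ((m + 1 : ℕ) : ℝ)) atTop (𝓝 0) :=
      tendsto_const_nhds.div_atTop
        (tendsto_natCast_atTop_atTop.comp (tendsto_add_atTop_nat 1))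
    have h := (tendsto_const_nhds (x := 1 - t)).sub hc
    rw [sub_zero] at h
    refine h.congr fun m => ?_
    have : ((m : ℝ) + 1) ≠ 0 := by positivity
    push_cast
    field_simp
    ring
  have hratio : Tendsto (fun m : ℕ => (u m : ℝ) / (m + 1 : ℕ)) atTop (𝓝 (1 - t)) := by
    have hc : Tendsto (fun m : ℕ => 1 / ((m + 1 : ℕ) : ℝ)) atTop (𝓝 0) :=
      tendsto_const_nhds.div_atTop
        (tendsto_natCast_atTop_atTop.comp (tendsto_add_atTop_nat 1))
    have hup := hlin.add hc
    rw [add_zero] at hup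
    refine tendsto_of_tendsto_of_tendsto_of_le_of_le' hlin hup
      (Eventually.of_forall fun m => ?_) ?_
    · exact div_le_div_of_nonneg_right (Nat.le_ceil _) (by positivity)
    -- `Nat.ceil` is `0` on negative arguments, so the upper bound needs the argument to be
    -- nonnegative, which holds eventually.
    · have hpos := hlin.eventually (lt_mem_nhds (show 0 < 1 - t by linarith))
      filter_upwards [hpos] with m hm
      rw [← add_div]
      refine div_le_div_of_nonneg_right (Nat.ceil_lt_add_one ?_).le (by positivity)
      by_contra hneg
      exact absurd hm (div_nonpos_of_nonpos_of_nonneg (not_le.1 hneg).le (by positivity)).not_gt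
  have huinf : Tendsto u atTop atTop := by
    have h := hratio.pos_mul_atTop (by linarith)
      (tendsto_natCast_atTop_atTop.comp (tendsto_add_atTop_nat 1))
    refine tendsto_natCast_atTop_iff.1 (h.congr fun m => ?_)
    have : (((m + 1 : ℕ)) : ℝ) ≠ 0 := by positivity
    simp only [Function.comp_apply]
    field_simp
  refine (tendsto_lowerMass hρ0 hρ1 hum (tendsto_growth_div_growth hρ0 huinf
    (tendsto_add_atTop_nat 1) hratio)).congr' ?_
  -- The word of all ones must lie in the event, since `lowerMass` counts it; this holds eventually
  -- because `t < 1`.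
  have hone : ∀ᶠ m : ℕ in atTop, t < ((m + 1 : ℕ) : ℝ) / ((m + 1 : ℕ) + a) :=
    ((tendsto_natCast_div_add_atTop (a : ℝ)).comp (tendsto_add_atTop_nat 1)).eventually
      (lt_mem_nhds h1)
  filter_upwards [hum, hone] with m hm h2
  rw [expect_succ hρ0, run_zero_ones, if_pos h2, lowerMass, mul_one]
  congr 1
  have h3 : ∀ r ∈ Finset.range m, (stepWeight ρ (m + 1) r * expect ρ r fun u =>
      if t < (run 0 (List.replicate (m - 1 - r) Letter.one ++ Letter.two :: u) : ℝ) /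
        (((m + 1 : ℕ) : ℝ) + a) then 1 else 0) =
      if r < u m then stepWeight ρ (m + 1) r else 0 := fun r hr => by
    rw [Finset.mem_range] at hr
    simp only [run_zero_ones_two]
    have hiff : t < ((m - 1 - r : ℕ) : ℝ) / (((m + 1 : ℕ) : ℝ) + a) ↔ r < u m := by
      rw [hu, Nat.lt_ceil, lt_div_iff₀ (by positivity), Nat.sub_sub, Nat.cast_sub (by omega)]
      push_cast
      constructor <;> intro h <;> linarith
    simp only [hiff]
    split_ifs
    · rw [expect_one hρ0, mul_one]
    · simp [expect]
  rw [Finset.sum_congr rfl h3, ← Finset.sum_filter]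
  refine Finset.sum_congr ?_ fun _ _ => rfl
  ext r
  simp only [Finset.mem_range, Finset.mem_filter]
  omega

/-! ### Joint limit of finitely many runs -/

/-- The normalized run with the denominator enlarged by `a`. -/
noncomputable def offsetRun (a n j : ℕ) (w : FibWord) : ℝ :=
  (run j w : ℝ) / ((n : ℝ) + a - ∑ i ∈ Finset.range j, (run i w : ℝ))

theorem offsetRun_zero (a n : ℕ) (w : FibWord) :
    offsetRun a n 0 w = (run 0 w : ℝ) / (n + a) := by
  simp [offsetRun]

/-- Since `n - k = r + 2`, removing `1ᵏ2` raises the offset by two. Hence the induction on the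
number of runs must treat all offsets at once. -/
theorem offsetRun_succ_ones_two (a n r k j : ℕ) (hn : r + 2 + k = n) (u : FibWord) :
    offsetRun a n (j + 1) (List.replicate k Letter.one ++ Letter.two :: u) =
      offsetRun (a + 2) r j u := by
  subst hn
  rw [offsetRun, offsetRun, Finset.sum_range_succ', run_zero_ones_two]
  simp only [run_succ_ones_two]
  congr 1
  push_cast
  ring

/-- Split at a fixed `R`: beyond it `d` is small, and the rest, including the word of all ones, is
at most `C` times a `lowerMass` that tends to zero. -/
theorem tendsto_average_of_tendsto_zero {ρ : ℝ} (hρ0 : 0 < ρ) (hρ1 : ρ ≤ 1) {C : ℝ}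
    {d : ℕ → ℝ} (hd0 : ∀ r, 0 ≤ d r) (hdC : ∀ r, d r ≤ C) (hd : Tendsto d atTop (𝓝 0)) :
    Tendsto (fun m => ρ ^ (m + 1) / rising ρ (m + 1) * C +
      ∑ r ∈ Finset.range m, stepWeight ρ (m + 1) r * d r) atTop (𝓝 0) := by
  have hC : 0 ≤ C := (hd0 0).trans (hdC 0)
  have hA : ∀ m, 0 ≤ ρ ^ (m + 1) / rising ρ (m + 1) := fun m => by
    have := rising_pos hρ0 (m + 1)
    positivity
  refine tendsto_order.2 ⟨fun b hb => Eventually.of_forall fun m => hb.trans_le ?_,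
    fun ε hε => ?_⟩
  · exact add_nonneg (mul_nonneg (hA m) hC) (Finset.sum_nonneg fun r _ =>
      mul_nonneg (stepWeight_nonneg hρ0 hρ1 _ _) (hd0 r))
  obtain ⟨R, hR⟩ := eventually_atTop.1 (hd.eventually (gt_mem_nhds (half_pos hε)))
  have hlow := (tendsto_lowerMass_const hρ0 hρ1 R).const_mul C
  rw [mul_zero] at hlow
  filter_upwards [hlow.eventually (gt_mem_nhds (half_pos hε)), eventually_ge_atTop R] with m hm hRm
  have hsplit : ∀ r ∈ Finset.range m, stepWeight ρ (m + 1) r * d r ≤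
      (if r < R then stepWeight ρ (m + 1) r * C else 0) + stepWeight ρ (m + 1) r * (ε / 2) := by
    intro r _
    have hs := stepWeight_nonneg hρ0 hρ1 (m + 1) r
    split_ifs with h
    · have h1 := mul_le_mul_of_nonneg_left (hdC r) hs
      have h2 := mul_nonneg hs (half_pos hε).le
      linarith
    · rw [zero_add]
      exact mul_le_mul_of_nonneg_left (hR r (not_lt.1 h)).le hs
  have hfil : (Finset.range m).filter (· < R) = Finset.range R := by
    ext r
    simp only [Finset.mem_range, Finset.mem_filter]
    omega
  have hsum := Finset.sum_le_sum hsplit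
  rw [Finset.sum_add_distrib, ← Finset.sum_filter, hfil, ← Finset.sum_mul, ← Finset.sum_mul] at hsum
  have htot := lowerMass_succ_self hρ0 m
  rw [lowerMass] at htot
  have hle : ∑ r ∈ Finset.range m, stepWeight ρ (m + 1) r ≤ 1 := by linarith [hA m]
  have h3 := mul_le_mul_of_nonneg_right hle (half_pos hε).le
  rw [lowerMass] at hm
  nlinarith

/-- Given the remaining weight `r`, the first factor is deterministic and the others have
expectation `G r`. Replacing `G r` by its limit `Λ` costs an average of `|G r - Λ|`, which vanishes,
and leaves `Λ` times a one-run expectation. -/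
theorem tendsto_expect_prod {ρ : ℝ} (hρ0 : 0 < ρ) (hρ1 : ρ ≤ 1) (k : ℕ) (f : Fin k → ℝ → ℝ)
    (L : Fin k → ℝ) (hf : ∀ j x, |f j x| ≤ 1)
    (hL : ∀ j (a : ℕ), Tendsto (fun n : ℕ => expect ρ n fun w => f j ((run 0 w : ℝ) / (n + a)))
      atTop (𝓝 (L j))) (a : ℕ) :
    Tendsto (fun n => expect ρ n fun w => ∏ j, f j (offsetRun a n j w)) atTop (𝓝 (∏ j, L j)) := by
  induction k generalizing a with
  | zero => simp [expect_one hρ0]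
  | succ k ih =>
    set Λ : ℝ := ∏ j : Fin k, L j.succ
    set G : ℕ → ℝ := fun r => expect ρ r fun u => ∏ j : Fin k, f j.succ (offsetRun (a + 2) r j u)
    have hG : Tendsto G atTop (𝓝 Λ) :=
      ih (fun j => f j.succ) (fun j => L j.succ) (fun j => hf j.succ) (fun j => hL j.succ) (a + 2)
    have hprod : ∀ (l : ℕ) (g : Fin l → ℝ), (∀ j, |g j| ≤ 1) → |∏ j, g j| ≤ 1 := fun l g hg => by
      rw [Finset.abs_prod]
      exact Finset.prod_le_one (fun _ _ => abs_nonneg _) fun j _ => hg j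
    have hG1 : ∀ r, |G r| ≤ 1 := fun r =>
      abs_expect_le_one hρ0 hρ1 r fun w => hprod _ _ fun j => hf _ _
    have hΛ1 : |Λ| ≤ 1 := le_of_tendsto' hG.abs hG1
    have hd : Tendsto (fun r => |G r - Λ|) atTop (𝓝 0) := by
      simpa using (hG.sub_const Λ).abs
    have hav := tendsto_average_of_tendsto_zero hρ0 hρ1 (C := 2) (fun r => abs_nonneg (G r - Λ))
      (fun r => (abs_sub _ _).trans (by linarith [hG1 r])) hd
    rw [← tendsto_add_atTop_iff_nat 1, Fin.prod_univ_succ]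
    have hfirst := ((tendsto_add_atTop_iff_nat 1).2 (hL 0 a)).mul_const Λ
    refine tendsto_of_tendsto_of_dist hfirst (squeeze_zero (fun _ => dist_nonneg) (fun m => ?_) hav)
    rw [Real.dist_eq, expect_succ hρ0, expect_succ hρ0 m]
    have hA : 0 ≤ ρ ^ (m + 1) / rising ρ (m + 1) := by
      have := rising_pos hρ0 (m + 1)
      positivity
    have hstep : ∀ r ∈ Finset.range m,
        |stepWeight ρ (m + 1) r * (expect ρ r fun u => f 0 ((run 0 (List.replicate (m - 1 - r)
          Letter.one ++ Letter.two :: u) : ℝ) / (((m + 1 : ℕ) : ℝ) + a))) * Λ -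
        stepWeight ρ (m + 1) r * (expect ρ r fun u => ∏ j : Fin (k + 1), f j (offsetRun a (m + 1) j
          (List.replicate (m - 1 - r) Letter.one ++ Letter.two :: u)))| ≤
        stepWeight ρ (m + 1) r * |G r - Λ| := by
      intro r hr
      rw [Finset.mem_range] at hr
      have h1 : (expect ρ r fun u => ∏ j : Fin (k + 1), f j (offsetRun a (m + 1) j
          (List.replicate (m - 1 - r) Letter.one ++ Letter.two :: u))) =
          f 0 (((m - 1 - r : ℕ) : ℝ) / (((m + 1 : ℕ) : ℝ) + a)) * G r := by
        rw [← expect_const_mul]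
        refine expect_congr fun u _ => ?_
        rw [Fin.prod_univ_succ, Fin.val_zero, offsetRun_zero, run_zero_ones_two]
        congr 1
        refine Finset.prod_congr rfl fun j _ => ?_
        rw [Fin.val_succ, offsetRun_succ_ones_two _ _ r _ _ (by omega)]
      have h2 : ∀ c : ℝ, (expect ρ r fun _ => c) = c := fun c => by
        have := expect_const_mul ρ r c fun _ => 1
        rwa [expect_one hρ0, mul_one] at this
      simp only [run_zero_ones_two]
      rw [h1, h2, mul_assoc, ← mul_sub, ← mul_sub, abs_mul, abs_mul,
        abs_of_nonneg (stepWeight_nonneg hρ0 hρ1 _ _), abs_sub_comm Λ]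
      exact mul_le_mul_of_nonneg_left (mul_le_of_le_one_left (abs_nonneg _) (hf _ _))
        (stepWeight_nonneg hρ0 hρ1 _ _)
    rw [add_mul, add_sub_add_comm, Finset.sum_mul, ← Finset.sum_sub_distrib]
    refine (abs_add_le _ _).trans (add_le_add ?_
      ((Finset.abs_sum_le_sum_abs _ _).trans (Finset.sum_le_sum hstep)))
    rw [mul_assoc, ← mul_sub, abs_mul, abs_of_nonneg hA]
    refine mul_le_mul_of_nonneg_left ((abs_sub _ _).trans ?_) hA
    have h1 := hprod (k + 1) _ fun j => hf j (offsetRun a (m + 1) j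
      (List.replicate (m + 1) Letter.one))
    have h2 : |f 0 ((run 0 (List.replicate (m + 1) Letter.one) : ℝ) / (((m + 1 : ℕ) : ℝ) + a)) * Λ|
        ≤ 1 := by
      rw [abs_mul]
      exact mul_le_one₀ (hf _ _) (abs_nonneg _) hΛ1
    linarith

/-! ### The limit law -/

open MeasureTheory ProbabilityTheory Set

theorem lintegral_Ioo_beta {ρ s : ℝ} (hρ : 0 < ρ) (hs : s ≤ 1) :
    ∫⁻ x in Ioo s 1, ENNReal.ofReal (ρ * (1 - x) ^ (ρ - 1)) = ENNReal.ofReal ((1 - s) ^ ρ) := by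
  have hint : IntervalIntegrable (fun x : ℝ => ρ * (1 - x) ^ (ρ - 1)) volume s 1 := by
    -- Reflecting by `x ↦ 1 - x` moves the possible singularity to `0`, where the exponent `ρ - 1 >
    -- -1` is integrable.
    have h := (intervalIntegral.intervalIntegrable_rpow' (a := 1 - s) (b := 1 - 1)
      (by linarith : -1 < ρ - 1)).comp_sub_left 1
    simpa using h.const_mul ρ
  rw [← ofReal_integral_eq_lintegral_ofReal
    ((intervalIntegrable_iff_integrableOn_Ioo_of_le hs).1 hint)]
  · rw [← integral_Ioc_eq_integral_Ioo, ← intervalIntegral.integral_of_le hs,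
      intervalIntegral.integral_const_mul,
      intervalIntegral.integral_comp_sub_left (fun x : ℝ => x ^ (ρ - 1)) 1,
      integral_rpow (Or.inl (by linarith)), sub_self, sub_add_cancel, Real.zero_rpow hρ.ne',
      sub_zero, mul_div_cancel₀ _ hρ.ne']
  · refine ae_restrict_of_forall_mem measurableSet_Ioo fun x hx => ?_
    have : 0 < 1 - x := by linarith [hx.2]
    positivity

theorem betaMeasure_one_Ioi {ρ : ℝ} (hρ : 0 < ρ) (t : ℝ) :
    betaMeasure 1 ρ (Ioi t) =
      ∫⁻ x in Ioo (max 0 t) 1, ENNReal.ofReal (ρ * (1 - x) ^ (ρ - 1)) := by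
  have hb : beta 1 ρ = 1 / ρ := by
    rw [beta, Real.Gamma_one, add_comm 1 ρ, Real.Gamma_add_one hρ.ne']
    have := (Real.Gamma_pos_of_pos hρ).ne'
    field_simp
  have hpdf : betaPDF 1 ρ =
      (Ioo (0 : ℝ) 1).indicator fun x => ENNReal.ofReal (ρ * (1 - x) ^ (ρ - 1)) := by
    ext x
    rw [betaPDF_eq, indicator_apply]
    simp only [mem_Ioo, hb]
    split_ifs <;> simp
  rw [betaMeasure, withDensity_apply _ measurableSet_Ioi, hpdf,
    setLIntegral_indicator measurableSet_Ioo]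
  congr 2
  ext x
  simp only [mem_inter_iff, mem_Ioo, mem_Ioi, max_lt_iff]
  tauto

theorem isProbabilityMeasure_etaLaw {ρ : ℝ} (hρ0 : 0 < ρ) (hρ1 : ρ ≤ 1) :
    IsProbabilityMeasure (etaLaw ρ) := by
  have := isProbabilityMeasureBeta one_pos hρ0
  constructor
  rw [etaLaw]
  simp [← ENNReal.ofReal_add hρ0.le (sub_nonneg.2 hρ1)]

theorem etaLaw_Ioi {ρ t : ℝ} (hρ0 : 0 < ρ) (hρ1 : ρ ≤ 1) (ht : t ≠ 0) :
    etaLaw ρ (Ioi t) = ENNReal.ofReal (etaTail ρ t) := by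
  rw [etaLaw, etaTail, Measure.add_apply, Measure.smul_apply, Measure.smul_apply,
    betaMeasure_one_Ioi hρ0, Measure.dirac_apply' _ measurableSet_Ioi]
  rcases lt_or_gt_of_ne ht with h0 | h0
  · rw [max_eq_left h0.le, lintegral_Ioo_beta hρ0 zero_le_one, if_pos h0]
    simp [h0, ← ENNReal.ofReal_add hρ0.le (sub_nonneg.2 hρ1)]
  · rw [max_eq_right h0.le, if_neg h0.not_gt]
    split_ifs with h1
    · rw [lintegral_Ioo_beta hρ0 h1.le, ENNReal.ofReal_mul (sub_nonneg.2 hρ1)]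
      simp [h0.le]
    · simp [Ioo_eq_empty h1, h0.le]

theorem etaLaw_real_Ioc {ρ c d : ℝ} (hρ0 : 0 < ρ) (hρ1 : ρ ≤ 1) (hc : c ≠ 0) (hd : d ≠ 0)
    (hcd : c ≤ d) : (etaLaw ρ).real (Ioc c d) = etaTail ρ c - etaTail ρ d := by
  have := isProbabilityMeasure_etaLaw hρ0 hρ1
  have hnonneg : ∀ t, 0 ≤ etaTail ρ t := fun t => by
    rw [etaTail]
    split_ifs with h0 h1
    · exact zero_le_one
    · exact mul_nonneg (sub_nonneg.2 hρ1) (Real.rpow_nonneg (by linarith) _)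
    · exact le_rfl
  have h : ∀ t, t ≠ 0 → (etaLaw ρ).real (Ioi t) = etaTail ρ t := fun t ht => by
    rw [measureReal_def, etaLaw_Ioi hρ0 hρ1 ht, ENNReal.toReal_ofReal (hnonneg t)]
  rw [← Ioi_sdiff_Ioi, measureReal_sdiff (Ioi_subset_Ioi hcd) measurableSet_Ioi, h c hc, h d hd]

/-! ### From expectations to convergence in distribution -/

open Classical in
theorem charlierMeasure_apply {ρ : ℝ} (hρ0 : 0 < ρ) (hρ1 : ρ ≤ 1) (n : ℕ) (p : FibWord → Prop) :
    charlierMeasure ρ n {w | p w.1} =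
      ENNReal.ofReal (expect ρ n fun w => if p w then 1 else 0) := by
  let hfin : Fintype (YF n) := Fintype.subtype (words n) fun _ => mem_words
  have hms : ∀ s : Set (YF n), MeasurableSet s := fun _ => trivial
  rw [charlierMeasure, Measure.sum_apply _ (hms _), tsum_fintype, expect,
    ENNReal.ofReal_sum_of_nonneg fun w _ =>
      mul_nonneg (charlierWeight_nonneg hρ0 hρ1 w) (by split_ifs <;> simp)]
  refine Eq.trans ?_ (Finset.sum_subtype (F := hfin) (words n) (fun _ => mem_words) _).symm
  refine Finset.sum_congr rfl fun w _ => ?_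
  rw [Measure.smul_apply, Measure.dirac_apply' _ (hms _), indicator_apply, charlierWeight]
  by_cases h : p w.1 <;> simp [h]

theorem isProbabilityMeasure_charlierMeasure {ρ : ℝ} (hρ0 : 0 < ρ) (hρ1 : ρ ≤ 1) (n : ℕ) :
    IsProbabilityMeasure (charlierMeasure ρ n) := by
  have h := charlierMeasure_apply hρ0 hρ1 n fun _ => True
  simp only [if_true, expect_one hρ0, ENNReal.ofReal_one] at h
  exact ⟨h⟩

theorem tendsto_expect_indicator_Ioc {ρ c d : ℝ} (hρ0 : 0 < ρ) (hρ1 : ρ ≤ 1) (hc : c ≠ 0)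
    (hd : d ≠ 0) (hcd : c ≤ d) (a : ℕ) :
    Tendsto (fun n : ℕ => expect ρ n fun w =>
      (Ioc c d).indicator (fun _ => (1 : ℝ)) ((run 0 w : ℝ) / (n + a))) atTop
      (𝓝 ((etaLaw ρ).real (Ioc c d))) := by
  classical
  rw [etaLaw_real_Ioc hρ0 hρ1 hc hd hcd]
  refine ((tendsto_expect_tail hρ0 hρ1 hc a).sub (tendsto_expect_tail hρ0 hρ1 hd a)).congr
    fun n => ?_
  rw [← expect_sub]
  refine expect_congr fun w _ => ?_
  simp only [indicator_apply, mem_Ioc]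
  generalize (run 0 w : ℝ) / (n + a) = x
  rcases lt_or_ge c x with h1 | h1
  · rcases lt_or_ge d x with h2 | h2
    · simp [h1, h2]
    · simp [h1, h2, h2.not_gt]
  · simp [h1.not_gt, (h1.trans hcd).not_gt]

/-- Boxes of half-open intervals whose endpoints are nonzero. -/
def nonzeroBoxes (ι : Type*) : Set (Set (ι → ℝ)) :=
  {s | ∃ c d : ι → ℝ, (∀ j, c j ≠ 0 ∧ d j ≠ 0 ∧ c j ≤ d j) ∧
    s = univ.pi fun j => Ioc (c j) (d j)}

theorem isPiSystem_nonzeroBoxes (ι : Type*) : IsPiSystem (nonzeroBoxes ι) := by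
  rintro _ ⟨c, d, h, rfl⟩ _ ⟨c', d', h', rfl⟩ ⟨x, hx, hx'⟩
  refine ⟨fun j => max (c j) (c' j), fun j => min (d j) (d' j), fun j => ⟨?_, ?_, ?_⟩, ?_⟩
  · change max (c j) (c' j) ≠ 0
    rcases max_choice (c j) (c' j) with h1 | h1 <;> rw [h1]
    exacts [(h j).1, (h' j).1]
  · change min (d j) (d' j) ≠ 0
    rcases min_choice (d j) (d' j) with h1 | h1 <;> rw [h1]
    exacts [(h j).2.1, (h' j).2.1]
  · have h1 := hx j trivial
    have h2 := hx' j trivial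
    exact (max_lt h1.1 h2.1).le.trans (le_min h1.2 h2.2)
  · rw [← pi_inter_distrib]
    simp only [Ioc_inter_Ioc]

/-- Together with the π-system property, this lets convergence on the boxes imply weak convergence.
Endpoints may avoid `0`, the atom of the limit law, because nonzero reals are dense. -/
theorem exists_nonzeroBoxes_subset {ι : Type*} [Fintype ι] {u : Set (ι → ℝ)} (hu : IsOpen u)
    {x : ι → ℝ} (hx : x ∈ u) : ∃ s ∈ nonzeroBoxes ι, s ∈ 𝓝 x ∧ s ⊆ u := by
  obtain ⟨ε, hε, hball⟩ := Metric.isOpen_iff.1 hu x hx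
  have hpick : ∀ p q : ℝ, p < q → ∃ r, p < r ∧ r < q ∧ r ≠ 0 := fun p q hpq => by
    rcases lt_or_ge p 0 with hp | hp
    · obtain ⟨r, h1, h2⟩ := exists_between (lt_min hpq hp)
      exact ⟨r, h1, h2.trans_le (min_le_left _ _), (h2.trans_le (min_le_right _ _)).ne⟩
    · obtain ⟨r, h1, h2⟩ := exists_between hpq
      exact ⟨r, h1, h2, (hp.trans_lt h1).ne'⟩
  choose c hc1 hc2 hc0 using fun j => hpick (x j - ε) (x j) (by linarith)
  choose d hd1 hd2 hd0 using fun j => hpick (x j) (x j + ε) (by linarith)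
  refine ⟨_, ⟨c, d, fun j => ⟨hc0 j, hd0 j, ((hc2 j).trans (hd1 j)).le⟩, rfl⟩,
    set_pi_mem_nhds finite_univ fun j _ => Ioc_mem_nhds (hc2 j) (hd1 j), fun y hy => hball ?_⟩
  rw [Metric.mem_ball, dist_pi_lt_iff hε]
  intro j
  have h := hy j trivial
  rw [Real.dist_eq, abs_lt]
  constructor <;> linarith [h.1, h.2, hc1 j, hd2 j]

theorem normalizedRun_eq_offsetRun (n j : ℕ) (w : FibWord) :
    normalizedRun n j w = offsetRun 0 n j w := by
  simp [normalizedRun, offsetRun]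

theorem tendstoInDistribution_normalizedRun {ρ : ℝ} (hρ0 : 0 < ρ) (hρ1 : ρ ≤ 1)
    [∀ n, IsProbabilityMeasure (charlierMeasure ρ n)] (k : ℕ) {Ω : Type*} [MeasurableSpace Ω]
    (P : Measure Ω) [IsProbabilityMeasure P] (η : Fin k → Ω → ℝ)
    (hη : ∀ j, HasLaw (η j) (etaLaw ρ) P) (hindep : iIndepFun η P) :
    TendstoInDistribution (fun (n : ℕ) (w : YF n) (j : Fin k) => normalizedRun n j w.1) atTop
      (fun ω j => η j ω) (fun n => charlierMeasure ρ n) P where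
  forall_aemeasurable n := (measurable_from_top).aemeasurable
  aemeasurable_limit := aemeasurable_pi_lambda _ fun j => (hη j).aemeasurable
  tendsto := by
    classical
    have hmeas : ∀ s ∈ nonzeroBoxes (Fin k), MeasurableSet s := by
      rintro _ ⟨c, d, -, rfl⟩
      exact MeasurableSet.univ_pi fun _ => measurableSet_Ioc
    refine (isPiSystem_nonzeroBoxes (Fin k)).tendsto_probabilityMeasure_of_tendsto_of_mem hmeas
      (fun u hu x hx => exists_nonzeroBoxes_subset hu hx) fun s hs => ?_
    have hs' := hmeas s hs
    obtain ⟨c, d, hcd, rfl⟩ := hs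
    rw [← NNReal.tendsto_coe]
    have hlim : (P.map fun ω j => η j ω).real (univ.pi fun j => Ioc (c j) (d j)) =
        ∏ j, (etaLaw ρ).real (Ioc (c j) (d j)) := by
      rw [map_measureReal_apply_of_aemeasurable
        (aemeasurable_pi_lambda _ fun j => (hη j).aemeasurable) hs']
      have h := hindep.measure_inter_preimage_eq_mul Finset.univ
        (sets := fun j => Ioc (c j) (d j)) fun _ _ => measurableSet_Ioc
      have hset : (fun ω j => η j ω) ⁻¹' (univ.pi fun j => Ioc (c j) (d j)) =
          ⋂ j ∈ (Finset.univ : Finset (Fin k)), η j ⁻¹' Ioc (c j) (d j) := by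
        ext ω
        simp
      rw [hset, measureReal_def, h, ENNReal.toReal_prod]
      refine Finset.prod_congr rfl fun j _ => ?_
      rw [measureReal_def, ← (hη j).map_eq,
        Measure.map_apply_of_aemeasurable (hη j).aemeasurable measurableSet_Ioc]
    have hpre : ∀ n : ℕ, ((charlierMeasure ρ n).map
        fun (w : YF n) (j : Fin k) => normalizedRun n j w.1).real
          (univ.pi fun j => Ioc (c j) (d j)) =
        expect ρ n fun w => ∏ j : Fin k,
          (Ioc (c j) (d j)).indicator (fun _ => (1 : ℝ)) (offsetRun 0 n j w) := fun n => by
      rw [map_measureReal_apply measurable_from_top hs', measureReal_def]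
      have h := charlierMeasure_apply hρ0 hρ1 n
        fun w => ∀ j : Fin k, offsetRun 0 n j w ∈ Ioc (c j) (d j)
      have hset : (fun (w : YF n) (j : Fin k) => normalizedRun n j w.1) ⁻¹'
          (univ.pi fun j => Ioc (c j) (d j)) =
          {w | ∀ j : Fin k, offsetRun 0 n j w.1 ∈ Ioc (c j) (d j)} := by
        ext w
        simp [normalizedRun_eq_offsetRun]
      rw [hset, h, ENNReal.toReal_ofReal]
      · refine expect_congr fun w _ => ?_
        simp only [indicator_apply, Finset.prod_ite_zero, Finset.mem_univ, true_implies,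
          Finset.prod_const_one]
        congr
      · refine Finset.sum_nonneg fun w _ => mul_nonneg (charlierWeight_nonneg hρ0 hρ1 w) ?_
        dsimp only
        split_ifs <;> simp
    -- The indicator of a box is a product of indicators of intervals, so box probabilities are
    -- product expectations.
    have key := tendsto_expect_prod hρ0 hρ1 k
      (fun j => (Ioc (c j) (d j)).indicator fun _ => (1 : ℝ))
      (fun j => (etaLaw ρ).real (Ioc (c j) (d j)))
      (fun j x => by rw [indicator_apply]; split_ifs <;> simp)
      (fun j a => tendsto_expect_indicator_Ioc hρ0 hρ1 (hcd j).1 (hcd j).2.1 (hcd j).2.2 a) 0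
    rw [← hlim] at key
    exact key.congr fun n => (hpre n).symm

/-! ### Stick-breaking form -/

theorem prod_one_sub_normalizedRun (w : FibWord) (j : ℕ) :
    (∏ i ∈ Finset.range j, (1 - normalizedRun (weight w) i w)) * (weight w : ℝ) =
      weight w - ∑ i ∈ Finset.range j, (run i w : ℝ) := by
  induction j with
  | zero => simp
  | succ j ih =>
    rw [Finset.prod_range_succ, mul_right_comm, ih, normalizedRun, Finset.sum_range_succ]
    have h : (∑ i ∈ Finset.range j, (run i w : ℝ)) + run j w ≤ weight w := by
      have h := sum_run_le_weight (j + 1) w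
      rw [Finset.sum_range_succ] at h
      exact_mod_cast h
    have hj : (0 : ℝ) ≤ run j w := by positivity
    generalize ∑ i ∈ Finset.range j, (run i w : ℝ) = S at *
    -- If nothing is left, the next run is `0` as well, so the convention `0 / 0 = 0` is harmless.
    rcases eq_or_ne ((weight w : ℝ) - S) 0 with h0 | h0
    · rw [h0]
      linarith
    · rw [mul_sub, mul_one, mul_div_cancel₀ _ h0]
      ring

theorem stick_breaking_normalizedRun (w : FibWord) (j : ℕ) :
    (∏ i ∈ Finset.range j, (1 - normalizedRun (weight w) i w)) * normalizedRun (weight w) j w =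
      (run j w : ℝ) / weight w := by
  have hD := prod_one_sub_normalizedRun w j
  have h : (∑ i ∈ Finset.range j, (run i w : ℝ)) + run j w ≤ weight w := by
    have h := sum_run_le_weight (j + 1) w
    rw [Finset.sum_range_succ] at h
    exact_mod_cast h
  have hS : 0 ≤ ∑ i ∈ Finset.range j, (run i w : ℝ) := by positivity
  have hj : (0 : ℝ) ≤ run j w := by positivity
  conv_lhs => rw [normalizedRun.eq_def (weight w) j]
  rw [← hD]
  rcases eq_or_ne (run j w : ℝ) 0 with h0 | h0
  · simp [h0]
  · have hne : (∏ i ∈ Finset.range j, (1 - normalizedRun (weight w) i w)) * (weight w : ℝ) ≠ 0 := by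
      rw [hD]
      intro h1
      exact h0 (by linarith)
    have h1 := left_ne_zero_of_mul hne
    have h2 := right_ne_zero_of_mul hne
    field_simp

/-- The stick-breaking map is polynomial, hence continuous, and sends the normalized runs exactly to
`r_j / n`. -/
theorem tendstoInDistribution_run_div {ρ : ℝ} (hρ0 : 0 < ρ) (hρ1 : ρ ≤ 1)
    [∀ n, IsProbabilityMeasure (charlierMeasure ρ n)] (k : ℕ) {Ω : Type*} [MeasurableSpace Ω]
    (P : Measure Ω) [IsProbabilityMeasure P] (η : Fin k → Ω → ℝ)
    (hη : ∀ j, HasLaw (η j) (etaLaw ρ) P) (hindep : iIndepFun η P) :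
    TendstoInDistribution (fun (n : ℕ) (w : YF n) (j : Fin k) => (run j w.1 : ℝ) / (n : ℝ)) atTop
      (fun ω j => (∏ i ∈ Finset.Iio j, (1 - η i ω)) * η j ω)
      (fun n => charlierMeasure ρ n) P := by
  have hg : Continuous fun (x : Fin k → ℝ) (j : Fin k) =>
      (∏ i ∈ Finset.Iio j, (1 - x i)) * x j := by fun_prop
  have h := (tendstoInDistribution_normalizedRun hρ0 hρ1 k P η hη hindep).continuous_comp hg
  have hX : (fun (n : ℕ) (w : YF n) (j : Fin k) => (run j w.1 : ℝ) / (n : ℝ)) = fun n =>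
      (fun (x : Fin k → ℝ) (j : Fin k) => (∏ i ∈ Finset.Iio j, (1 - x i)) * x j) ∘
        fun (w : YF n) (j : Fin k) => normalizedRun n j w.1 := by
    funext n w j
    obtain ⟨w, rfl⟩ := w
    have hIio : ∏ i ∈ Finset.Iio j, (1 - normalizedRun (weight w) i w) =
        ∏ i ∈ Finset.range j, (1 - normalizedRun (weight w) i w) := by
      rw [← Nat.Iio_eq_range, ← Fin.map_valEmbedding_Iio, Finset.prod_map]
      rfl
    exact ((congrArg (· * normalizedRun (weight w) j w) hIio).trans
      (stick_breaking_normalizedRun w j)).symm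
  rw [hX]
  exact h

end YoungFibonacci

theorem mainTheorem2 (ρ : ℝ) (hρ0 : 0 < ρ) (hρ1 : ρ < 1) :
    (∀ w : YoungFibonacci.FibWord,
      0 ≤ YoungFibonacci.cloneWeight (YoungFibonacci.charlierX ρ) (YoungFibonacci.charlierY ρ) w) ∧
    ∃ _ : ∀ n : ℕ, MeasureTheory.IsProbabilityMeasure (YoungFibonacci.charlierMeasure ρ n),
      ∀ (k : ℕ) {Ω : Type*} [MeasurableSpace Ω] (P : MeasureTheory.Measure Ω)
        [MeasureTheory.IsProbabilityMeasure P] (η : Fin k → Ω → ℝ),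
        (∀ j : Fin k, ProbabilityTheory.HasLaw (η j) (YoungFibonacci.etaLaw ρ) P) →
        ProbabilityTheory.iIndepFun η P →
        MeasureTheory.TendstoInDistribution
          (fun (n : ℕ) (w : YoungFibonacci.YF n) (j : Fin k) =>
            YoungFibonacci.normalizedRun n j w.1)
          Filter.atTop
          (fun ω j => η j ω)
          (fun n => YoungFibonacci.charlierMeasure ρ n) P ∧
        MeasureTheory.TendstoInDistribution
          (fun (n : ℕ) (w : YoungFibonacci.YF n) (j : Fin k) =>
            (YoungFibonacci.run j w.1 : ℝ) / (n : ℝ))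
          Filter.atTop
          (fun ω j => (∏ i ∈ Finset.Iio j, (1 - η i ω)) * η j ω)
          (fun n => YoungFibonacci.charlierMeasure ρ n) P := by
  refine ⟨YoungFibonacci.charlierWeight_nonneg hρ0 hρ1.le,
    YoungFibonacci.isProbabilityMeasure_charlierMeasure hρ0 hρ1.le, ?_⟩
  intro k Ω _ P _ η hη hindep
  have := YoungFibonacci.isProbabilityMeasure_charlierMeasure hρ0 hρ1.le
  exact ⟨YoungFibonacci.tendstoInDistribution_normalizedRun hρ0 hρ1.le k P η hη hindep,
    YoungFibonacci.tendstoInDistribution_run_div hρ0 hρ1.le k P η hη hindep⟩
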